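/- Let $X$ be an infinite-dimensional complex Banach space and let $A\neq 0$ be a scalar type spectral operator in $X$, i.e. a (possibly unbounded) densely defined closed linear operator $A:D(A)\subseteq X\to X$ for which there is a strongly $\sigma$-additive projection-valued measure $E$ on the Borel sets of $\mathbb C$, with $E(\mathbb C)=I$, $E(\delta\cap\delta')=E(\delta)E(\delta')$ and support equal to the spectrum $\sigma(A)$, such that $A=\int_{\sigma(A)}\lambda\,dE(\lambda)$, that is, $D(A)$ is the set of all $x\in X$ for which $\lim_{n\to\infty}\int_{\{\lambda\in\sigma(A):|\lambda|\le n\}}\lambda\,dE(\lambda)\,x$ exists, and $Ax$ is this limit. Then $A$ is compact (in particular, everywhere defined and bounded) if and only if the following two conditions hold: (i) $\sigma(A)$ consists of $0$ and a nonempty countable (finite or countably infinite) set of nonzero eigenvalues of $A$ with finite geometric multiplicities; (ii) if the set $\sigma(A)\setminus\{0\}$ is infinite, then for every arrangement $\{\lambda_n\}_{n=1}^\infty$ of it (i.e. every bijection $\mathbb N\ni n\mapsto\lambda_n\in\sigma(A)\setminus\{0\}$), $\lambda_n\to 0$ as $n\to\infty$. -/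

import Mathlib

open Filter Topology MeasureTheory

namespace ScalarSpectral

variable {X : Type*} [NormedAddCommGroup X] [NormedSpace ℂ X]

/-- A strongly `σ`-additive projection-valued measure on the Borel sets of the complex plane.
Values on non-Borel sets are irrelevant. Multiplicativity makes every `E s` (with `s` Borel)
a projection, and `E ∅ = 0` follows from `σ`-additivity. -/
structure SpectralMeasure (X : Type*) [NormedAddCommGroup X] [NormedSpace ℂ X] where
  toFun : Set ℂ → X →L[ℂ] X
  univ' : toFun Set.univ = ContinuousLinearMap.id ℂ X
  inter' : ∀ s t : Set ℂ, MeasurableSet s → MeasurableSet t →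
    toFun (s ∩ t) = (toFun s).comp (toFun t)
  iUnion' : ∀ s : ℕ → Set ℂ, (∀ n, MeasurableSet (s n)) →
    Pairwise (Function.onFun Disjoint s) →
    ∀ x : X, HasSum (fun n => toFun (s n) x) (toFun (⋃ n, s n) x)

namespace SpectralMeasure

/-- The support: the complement of the union of all open sets `U` with `E U = 0`. -/
def support (E : SpectralMeasure X) : Set ℂ :=
  {z | ∀ U : Set ℂ, IsOpen U → z ∈ U → E.toFun U ≠ 0}

/-- The integral of a simple function `∑ c • 1_{F = c}`, i.e. `∑ c • E {F = c}`. -/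
noncomputable def simpleIntegral (E : SpectralMeasure X) (F : SimpleFunc ℂ ℂ) : X →L[ℂ] X :=
  ∑ c ∈ F.range, c • E.toFun (F ⁻¹' {c})

/-- `T = ∫ F dE` for a bounded Borel function `F`: the limit in operator norm of the integrals of
simple functions that converge to `F` uniformly. -/
def HasBoundedIntegral (E : SpectralMeasure X) (F : ℂ → ℂ) (T : X →L[ℂ] X) : Prop :=
  ∃ s : ℕ → SimpleFunc ℂ ℂ, TendstoUniformly (fun n z => s n z) F atTop ∧
    Tendsto (fun n => E.simpleIntegral (s n)) atTop (𝓝 T)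

/-- `A = ∫_S F dE` for a possibly unbounded Borel function `F`: the domain of `A` consists of those
`x` for which `lim_n (∫_{z ∈ S, |F z| ≤ n} F dE) x` exists, and `A x` is this limit. -/
def HasIntegralOn (E : SpectralMeasure X) (S : Set ℂ) (F : ℂ → ℂ) (A : X →ₗ.[ℂ] X) : Prop :=
  ∀ x y : X, (x, y) ∈ A.graph ↔
    ∃ T : ℕ → X →L[ℂ] X,
      (∀ n : ℕ, E.HasBoundedIntegral (Set.indicator {z | z ∈ S ∧ ‖F z‖ ≤ n} F) (T n)) ∧
      Tendsto (fun n => T n x) atTop (𝓝 y)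

end SpectralMeasure

/-- The resolvent set of a linear operator `A : D(A) ⊆ X → X`: those `z` for which `A - z` is a
bijection of `D(A)` onto `X` with bounded inverse `R`. -/
def resolventSet (A : X →ₗ.[ℂ] X) : Set ℂ :=
  {z | ∃ R : X →L[ℂ] X,
    (∀ y : X, ∃ h : R y ∈ A.domain, A ⟨R y, h⟩ - z • R y = y) ∧
    (∀ x : A.domain, R (A x - z • (x : X)) = x)}

/-- The spectrum of a linear operator with domain in `X`. -/
def spectrum (A : X →ₗ.[ℂ] X) : Set ℂ := (resolventSet A)ᶜ

/-- The subspace `ker (A - z)`, i.e. all `x ∈ D(A)` with `A x = z • x`. -/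
def eigenspace (A : X →ₗ.[ℂ] X) (z : ℂ) : Submodule ℂ X :=
  A.graph.comap (LinearMap.prod LinearMap.id (z • LinearMap.id))

theorem mem_eigenspace_iff (A : X →ₗ.[ℂ] X) (z : ℂ) (x : X) :
    x ∈ eigenspace A z ↔ ∃ h : x ∈ A.domain, A ⟨x, h⟩ = z • x := by
  change (x, z • x) ∈ A.graph ↔ _
  rw [LinearPMap.mem_graph_iff]
  constructor
  · rintro ⟨y, rfl, h⟩
    exact ⟨y.2, h⟩
  · rintro ⟨h, e⟩
    exact ⟨⟨x, h⟩, rfl, e⟩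

/-- `z` is an eigenvalue of `A`. -/
def IsEigenvalue (A : X →ₗ.[ℂ] X) (z : ℂ) : Prop := eigenspace A z ≠ ⊥

/-- `A` is a compact operator: everywhere defined, and compact as a linear map. -/
def IsCompactOp (A : X →ₗ.[ℂ] X) : Prop :=
  A.domain = ⊤ ∧ IsCompactOperator (fun x : A.domain => A x)

/-- Scalar type spectral operators: densely defined closed operators `A` with a spectral measure
`E` supported on the spectrum of `A` such that `A` is the integral of `z` with respect to `E`. -/
def IsScalarTypeSpectral (A : X →ₗ.[ℂ] X) : Prop :=
  Dense (A.domain : Set X) ∧ A.IsClosed ∧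
    ∃ E : SpectralMeasure X, E.support = spectrum A ∧
      E.HasIntegralOn (spectrum A) (fun z => z) A

end ScalarSpectral

/-!
A spectral measure `E` on a Banach space is uniformly bounded, so integration of simple functions
is bounded for the supremum norm and extends to bounded Borel functions. The resulting integral is
unique, bounded and multiplicative (`SpectralMeasure.exists_hasBoundedIntegral`,
`SpectralMeasure.HasBoundedIntegral.unique`, `SpectralMeasure.exists_norm_le_of_hasBoundedIntegral`,
`SpectralMeasure.HasBoundedIntegral.mul`). The theorem follows from this calculus, without the
Riesz theory of compact operators. Write `σ` for the spectrum of `A`, which is the support of `E`.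

If `A` is compact, let `R` be the integral of `z⁻¹` over `{z ∈ σ : ε ≤ |z|}`. Then `A ∘ R` is the
projection `E {z ∈ σ : ε ≤ |z|}` (`exists_comp_eq_toFun`), which is therefore compact and of finite
rank. As every neighbourhood of a point of the support has a nonzero projection, only finitely many
points of `σ` satisfy `ε ≤ |z|` (`finite_spectrum_of_isCompactOperator`). Thus `σ \ {0}` is
countable with `0` as its only possible accumulation point, and each `z ∈ σ \ {0}` is isolated in `σ`. Hence
`E {z} ≠ 0`, and the range of `E {z}` consists of eigenvectors (`isEigenvalue_of_finite`). If
`σ ⊆ {0}`, then `A = ∫ z dE = 0`; and `0 ∈ σ` because a compact operator on an infinite-dimensional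
space has no bounded inverse.

Conversely, the conditions say that `{z ∈ σ : ε ≤ |z|}` is finite for every `ε > 0`. So `σ` is
bounded and `A` is the bounded operator `∫_σ z dE`. It is the norm limit, as `ε → 0`, of its
compositions with the projections `E {z ∈ σ : ε ≤ |z|}`, and these have finite rank, being finite
sums of projections `E {z}` into finite-dimensional eigenspaces (`isCompactOp_of_finite`).
-/

namespace ScalarSpectral

/-! ### Elementary properties of spectral measures -/

namespace SpectralMeasure

variable {X : Type*} [NormedAddCommGroup X] [NormedSpace ℂ X] (E : SpectralMeasure X)

theorem toFun_empty : E.toFun ∅ = 0 := by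
  ext x
  have h := (E.iUnion' (fun _ => ∅) (fun _ => MeasurableSet.empty)
    (fun _ _ _ => Set.disjoint_empty _) x).summable
  simpa [summable_const_iff] using h

open Classical in
/-- The `X`-valued vector measure `s ↦ E s x`, set to `0` on non-Borel sets as Mathlib's vector
measures require. -/
noncomputable def vectorMeasure (x : X) : VectorMeasure ℂ X where
  measureOf' s := if MeasurableSet s then E.toFun s x else 0
  empty' := by simp [toFun_empty]
  not_measurable' _ hs := if_neg hs
  m_iUnion' f hf hd := by
    simpa only [if_pos (hf _), if_pos (MeasurableSet.iUnion hf)] using E.iUnion' f hf hd x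

theorem vectorMeasure_apply (x : X) {s : Set ℂ} (hs : MeasurableSet s) :
    E.vectorMeasure x s = E.toFun s x :=
  if_pos hs

theorem toFun_union {s t : Set ℂ} (h : Disjoint s t) (hs : MeasurableSet s)
    (ht : MeasurableSet t) : E.toFun (s ∪ t) = E.toFun s + E.toFun t := by
  ext x
  simpa only [vectorMeasure_apply, hs, ht, hs.union ht, _root_.add_apply] using
    (E.vectorMeasure x).of_union h hs ht

theorem toFun_biUnion_finset {ι : Type*} (u : Finset ι) {f : ι → Set ℂ}
    (hd : (u : Set ι).PairwiseDisjoint f) (hf : ∀ i ∈ u, MeasurableSet (f i)) :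
    E.toFun (⋃ i ∈ u, f i) = ∑ i ∈ u, E.toFun (f i) := by
  ext x
  have h := (E.vectorMeasure x).of_biUnion_finset hd hf
  rw [vectorMeasure_apply _ _ (u.measurableSet_biUnion hf)] at h
  rw [h, _root_.sum_apply]
  exact Finset.sum_congr rfl fun i hi => E.vectorMeasure_apply x (hf i hi)

theorem tendsto_toFun_iUnion {s : ℕ → Set ℂ} (hm : Monotone s)
    (hs : ∀ n, MeasurableSet (s n)) (x : X) :
    Tendsto (fun n => E.toFun (s n) x) atTop (𝓝 (E.toFun (⋃ n, s n) x)) := by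
  simpa only [vectorMeasure_apply, hs, MeasurableSet.iUnion hs] using
    (E.vectorMeasure x).tendsto_vectorMeasure_iUnion_atTop_nat hm hs

theorem toFun_inter_apply {s t : Set ℂ} (hs : MeasurableSet s) (ht : MeasurableSet t) (x : X) :
    E.toFun s (E.toFun t x) = E.toFun (s ∩ t) x := by
  rw [E.inter' s t hs ht]; rfl

theorem isClosed_support : IsClosed E.support := by
  rw [← isOpen_compl_iff, isOpen_iff_forall_mem_open]
  intro z hz
  simp only [support, Set.mem_compl_iff, Set.mem_ofPred_eq, not_forall, not_not] at hz
  obtain ⟨U, hU, hzU, hE⟩ := hz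
  exact ⟨U, fun w hw hw' => hw' U hU hw hE, hU, hzU⟩

/-- The complement of the support is null, because it is a countable union of null open sets. -/
theorem toFun_compl_support : E.toFun E.supportᶜ = 0 := by
  have : ∀ z : ↥E.supportᶜ, ∃ U : Set ℂ, IsOpen U ∧ (z : ℂ) ∈ U ∧ E.toFun U = 0 := by
    rintro ⟨z, hz⟩
    simpa only [support, Set.mem_compl_iff, Set.mem_ofPred_eq, not_forall, not_not,
      exists_prop] using hz
  choose U hU hmem hE using this
  rcases isEmpty_or_nonempty ↥E.supportᶜ with he | hne
  · rw [Set.isEmpty_coe_sort.1 he, toFun_empty]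
  obtain ⟨k, hk⟩ := eq_open_union_nat U hU
  have hcov : (⋃ n, U (k n)) ∩ E.supportᶜ = E.supportᶜ := by
    rw [hk]
    exact Set.inter_eq_right.2 fun z hz => Set.mem_iUnion.2 ⟨⟨z, hz⟩, hmem _⟩
  have hmeas : ∀ n, MeasurableSet (U (k n)) := fun n => (hU _).measurableSet
  have hzero : E.toFun (⋃ n, U (k n)) = 0 := by
    ext x
    rw [← iUnion_disjointed]
    refine (E.iUnion' _ (MeasurableSet.disjointed hmeas) (disjoint_disjointed _) x).unique ?_
    rw [_root_.zero_apply]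
    convert hasSum_zero with n
    have : disjointed (fun n => U (k n)) n = disjointed (fun n => U (k n)) n ∩ U (k n) :=
      (Set.inter_eq_left.2 (disjointed_subset _ _)).symm
    rw [this, E.inter' _ _ (MeasurableSet.disjointed hmeas n) (hmeas n), hE]
    simp
  rw [← hcov, E.inter' _ _ (MeasurableSet.iUnion hmeas) E.isClosed_support.measurableSet.compl,
    hzero, ContinuousLinearMap.zero_comp]

theorem toFun_inter_support {s : Set ℂ} (hs : MeasurableSet s) :
    E.toFun (s ∩ E.support) = E.toFun s := by
  have hm := E.isClosed_support.measurableSet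
  conv_rhs => rw [← Set.inter_union_compl s E.support]
  rw [E.toFun_union (disjoint_compl_right.mono Set.inter_subset_right Set.inter_subset_right)
      (hs.inter hm) (hs.inter hm.compl), E.inter' s _ hs hm.compl, toFun_compl_support,
    ContinuousLinearMap.comp_zero, add_zero]

/-- A spectral measure is uniformly bounded: each vector measure `E(·) x` is bounded, and the
uniform boundedness principle applies. -/
theorem exists_norm_toFun_le [CompleteSpace X] :
    ∃ M : ℝ, 0 ≤ M ∧ ∀ s, MeasurableSet s → ‖E.toFun s‖ ≤ M := by
  obtain ⟨C, hC⟩ := banach_steinhaus (g := fun s : {s : Set ℂ // MeasurableSet s} => E.toFun s)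
    fun x => ⟨(E.vectorMeasure x).bound, fun s => by
      rw [← E.vectorMeasure_apply x s.2]
      exact VectorMeasure.norm_apply_le_bound⟩
  exact ⟨C, (norm_nonneg _).trans (hC ⟨∅, .empty⟩), fun s hs => hC ⟨s, hs⟩⟩

end SpectralMeasure

/-! ### Sums bounded over all subfamilies -/

theorem sum_abs_le_two_mul {ι : Type*} {u : Finset ι} {a : ι → ℝ} {M : ℝ}
    (h : ∀ t ⊆ u, |∑ i ∈ t, a i| ≤ M) : ∑ i ∈ u, |a i| ≤ 2 * M := by
  classical
  rw [← Finset.sum_filter_add_sum_filter_not u (fun i => 0 ≤ a i)]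
  have h1 := h _ (Finset.filter_subset (fun i => 0 ≤ a i) u)
  have h2 := h _ (Finset.filter_subset (fun i => ¬ 0 ≤ a i) u)
  have e1 : ∑ i ∈ u with 0 ≤ a i, |a i| = ∑ i ∈ u with 0 ≤ a i, a i :=
    Finset.sum_congr rfl fun i hi => abs_of_nonneg (Finset.mem_filter.1 hi).2
  have e2 : ∑ i ∈ u with ¬ 0 ≤ a i, |a i| = -∑ i ∈ u with ¬ 0 ≤ a i, a i := by
    rw [← Finset.sum_neg_distrib]
    exact Finset.sum_congr rfl fun i hi => abs_of_neg (not_le.1 (Finset.mem_filter.1 hi).2)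
  rw [e1, e2]
  linarith [abs_le.1 h1, abs_le.1 h2]

theorem sum_norm_le_four_mul {ι : Type*} {u : Finset ι} {a : ι → ℂ} {M : ℝ}
    (h : ∀ t ⊆ u, ‖∑ i ∈ t, a i‖ ≤ M) : ∑ i ∈ u, ‖a i‖ ≤ 4 * M := by
  have hre := sum_abs_le_two_mul (u := u) (a := fun i => (a i).re) fun t ht => by
    simpa using (Complex.abs_re_le_norm _).trans (h t ht)
  have him := sum_abs_le_two_mul (u := u) (a := fun i => (a i).im) fun t ht => by
    simpa using (Complex.abs_im_le_norm _).trans (h t ht)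
  calc ∑ i ∈ u, ‖a i‖ ≤ ∑ i ∈ u, (|(a i).re| + |(a i).im|) :=
        Finset.sum_le_sum fun i _ => Complex.norm_le_abs_re_add_abs_im _
    _ ≤ 4 * M := by rw [Finset.sum_add_distrib]; linarith

/-! ### Integrals of simple functions -/

namespace SpectralMeasure

variable {X : Type*} [NormedAddCommGroup X] [NormedSpace ℂ X] (E : SpectralMeasure X)

/-- Integration of simple functions is bounded for the supremum norm. Tested on a functional `f`
and a vector `x`, the integral is `∑ c • f (E {F = c} x)`, and the sums of the numbers
`f (E {F = c} x)` over sets of values `c` are controlled by the bound for `E`. -/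
theorem exists_norm_simpleIntegral_le [CompleteSpace X] :
    ∃ C : ℝ, 0 ≤ C ∧ ∀ (F : SimpleFunc ℂ ℂ) (K : ℝ), (∀ z, ‖F z‖ ≤ K) →
      ‖E.simpleIntegral F‖ ≤ C * K := by
  obtain ⟨M, hM, hE⟩ := E.exists_norm_toFun_le
  refine ⟨4 * M, by positivity, fun F K hF => ?_⟩
  have hK : 0 ≤ K := (norm_nonneg _).trans (hF 0)
  refine ContinuousLinearMap.opNorm_le_bound _ (by positivity) fun x => ?_
  refine NormedSpace.norm_le_dual_bound ℂ _ (by positivity) fun f => ?_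
  have key : ∑ c ∈ F.range, ‖f (E.toFun (F ⁻¹' {c}) x)‖ ≤ 4 * (‖f‖ * (M * ‖x‖)) := by
    refine sum_norm_le_four_mul fun t _ => ?_
    have hd : (t : Set ℂ).PairwiseDisjoint fun c => F ⁻¹' {c} := fun a _ b _ hab =>
      Disjoint.preimage _ (Set.disjoint_singleton.2 hab)
    have hm : ∀ c ∈ t, MeasurableSet (F ⁻¹' {c}) := fun c _ => F.measurableSet_fiber c
    have : ∑ c ∈ t, f (E.toFun (F ⁻¹' {c}) x) = f (E.toFun (⋃ c ∈ t, F ⁻¹' {c}) x) := by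
      rw [E.toFun_biUnion_finset t hd hm, _root_.sum_apply, map_sum]
    rw [this]
    exact (f.le_opNorm _).trans (mul_le_mul_of_nonneg_left
      (((E.toFun _).le_opNorm x).trans (mul_le_mul_of_nonneg_right
        (hE _ (t.measurableSet_biUnion hm)) (norm_nonneg _))) (norm_nonneg _))
  calc ‖f (E.simpleIntegral F x)‖
      = ‖∑ c ∈ F.range, c * f (E.toFun (F ⁻¹' {c}) x)‖ := by
        simp [simpleIntegral, _root_.sum_apply]
    _ ≤ ∑ c ∈ F.range, ‖c * f (E.toFun (F ⁻¹' {c}) x)‖ := norm_sum_le _ _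
    _ ≤ ∑ c ∈ F.range, K * ‖f (E.toFun (F ⁻¹' {c}) x)‖ := by
        refine Finset.sum_le_sum fun c hc => ?_
        obtain ⟨z, rfl⟩ := SimpleFunc.mem_range.1 hc
        rw [norm_mul]
        exact mul_le_mul_of_nonneg_right (hF z) (norm_nonneg _)
    _ ≤ K * (4 * (‖f‖ * (M * ‖x‖))) := by
        rw [← Finset.mul_sum]; exact mul_le_mul_of_nonneg_left key hK
    _ = 4 * M * K * ‖x‖ * ‖f‖ := by ring

/-- The real-linear map `c ↦ c • E s`, in the form used by Mathlib's extension of set functions to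
simple functions. -/
noncomputable def smulMap (s : Set ℂ) : ℂ →L[ℝ] (X →L[ℂ] X) :=
  (ContinuousLinearMap.id ℝ ℂ).smulRight (E.toFun s)

theorem simpleIntegral_eq_setToSimpleFunc (F : SimpleFunc ℂ ℂ) :
    E.simpleIntegral F = F.setToSimpleFunc E.smulMap := rfl

/-- The set function `smulMap` is additive; the zero measure is used as reference measure, so that
all Borel sets are admitted. -/
theorem finMeasAdditive_smulMap : FinMeasAdditive (0 : Measure ℂ) E.smulMap := by
  intro s t hs ht _ _ hd
  ext c
  simp [smulMap, E.toFun_union hd hs ht]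

theorem simpleIntegral_add (F G : SimpleFunc ℂ ℂ) :
    E.simpleIntegral (F + G) = E.simpleIntegral F + E.simpleIntegral G := by
  simp only [simpleIntegral_eq_setToSimpleFunc]
  exact SimpleFunc.setToSimpleFunc_add _ E.finMeasAdditive_smulMap (integrable_zero_measure)
    (integrable_zero_measure)

theorem simpleIntegral_sub (F G : SimpleFunc ℂ ℂ) :
    E.simpleIntegral (F - G) = E.simpleIntegral F - E.simpleIntegral G := by
  simp only [simpleIntegral_eq_setToSimpleFunc]
  exact SimpleFunc.setToSimpleFunc_sub _ E.finMeasAdditive_smulMap (integrable_zero_measure)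
    (integrable_zero_measure)

theorem simpleIntegral_piecewise_const {s : Set ℂ} (hs : MeasurableSet s) (c : ℂ) :
    E.simpleIntegral (SimpleFunc.piecewise s hs (SimpleFunc.const _ c) (SimpleFunc.const _ 0)) =
      c • E.toFun s := by
  rw [simpleIntegral_eq_setToSimpleFunc, SimpleFunc.setToSimpleFunc_indicator]
  · rfl
  · ext; simp [smulMap, toFun_empty]

theorem simpleIntegral_mul (F G : SimpleFunc ℂ ℂ) :
    E.simpleIntegral (F * G) = (E.simpleIntegral F).comp (E.simpleIntegral G) := by
  induction F using SimpleFunc.induction with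
  | add _ hF hF' => rw [add_mul, simpleIntegral_add, simpleIntegral_add, hF, hF',
      ContinuousLinearMap.add_comp]
  | const c hs =>
    rename_i s
    induction G using SimpleFunc.induction with
    | add _ hG hG' => rw [mul_add, simpleIntegral_add, simpleIntegral_add, hG, hG',
        ContinuousLinearMap.comp_add]
    | const d ht =>
      rename_i t
      have : SimpleFunc.piecewise s hs (SimpleFunc.const _ c) (SimpleFunc.const _ 0) *
          SimpleFunc.piecewise t ht (SimpleFunc.const _ d) (SimpleFunc.const _ 0) =
          SimpleFunc.piecewise (s ∩ t) (hs.inter ht) (SimpleFunc.const _ (c * d))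
            (SimpleFunc.const _ 0) := by
        ext z
        by_cases h1 : z ∈ s <;> by_cases h2 : z ∈ t <;>
          simp [Set.piecewise, h1, h2]
      rw [this]
      simp only [simpleIntegral_piecewise_const, E.inter' s t hs ht,
        ContinuousLinearMap.smul_comp, ContinuousLinearMap.comp_smul, smul_smul, mul_comm]

/-! ### Integrals of bounded Borel functions -/

variable {E}
variable {F G : ℂ → ℂ} {T S : X →L[ℂ] X}

theorem hasBoundedIntegral_simpleFunc (F : SimpleFunc ℂ ℂ) :
    E.HasBoundedIntegral F (E.simpleIntegral F) :=
  ⟨fun _ => F, fun _ hu => Eventually.of_forall fun _ _ => refl_mem_uniformity hu,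
    tendsto_const_nhds⟩

theorem hasBoundedIntegral_indicator_const {s : Set ℂ} (hs : MeasurableSet s) (c : ℂ) :
    E.HasBoundedIntegral (s.indicator fun _ => c) (c • E.toFun s) := by
  have h := hasBoundedIntegral_simpleFunc (E := E)
    (SimpleFunc.piecewise s hs (SimpleFunc.const _ c) (SimpleFunc.const _ 0))
  rw [simpleIntegral_piecewise_const] at h
  convert h using 1
  ext z
  by_cases hz : z ∈ s <;> simp [Set.piecewise, hz]

theorem hasBoundedIntegral_indicator_one {s : Set ℂ} (hs : MeasurableSet s) :
    E.HasBoundedIntegral (s.indicator fun _ => 1) (E.toFun s) := by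
  simpa using hasBoundedIntegral_indicator_const (E := E) hs 1

theorem HasBoundedIntegral.sub (hF : E.HasBoundedIntegral F T) (hG : E.HasBoundedIntegral G S) :
    E.HasBoundedIntegral (F - G) (T - S) := by
  obtain ⟨s, hs, hsT⟩ := hF
  obtain ⟨t, ht, htS⟩ := hG
  refine ⟨fun n => s n - t n, hs.sub ht, ?_⟩
  simp only [simpleIntegral_sub]
  exact hsT.sub htS

/-- Functions that have a bounded integral are bounded, as uniform limits of simple functions. -/
theorem exists_bound_of_tendstoUniformly {s : ℕ → SimpleFunc ℂ ℂ}
    (h : TendstoUniformly (fun n z => s n z) F atTop) : ∃ K : ℝ, ∀ z, ‖F z‖ ≤ K := by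
  obtain ⟨n, hn⟩ := (Metric.tendstoUniformly_iff.1 h 1 one_pos).exists
  obtain ⟨K, hK⟩ := (s n).exists_forall_norm_le
  refine ⟨1 + K, fun z => ?_⟩
  have h1 := hn z
  rw [dist_eq_norm] at h1
  calc ‖F z‖ = ‖(F z - s n z) + s n z‖ := by rw [sub_add_cancel]
    _ ≤ 1 + K := (norm_add_le _ _).trans (add_le_add h1.le (hK z))

theorem HasBoundedIntegral.mul (hF : E.HasBoundedIntegral F T) (hG : E.HasBoundedIntegral G S) :
    E.HasBoundedIntegral (F * G) (T.comp S) := by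
  obtain ⟨s, hs, hsT⟩ := hF
  obtain ⟨t, ht, htS⟩ := hG
  refine ⟨fun n => s n * t n, ?_, ?_⟩
  · obtain ⟨K, hK⟩ := exists_bound_of_tendstoUniformly hs
    obtain ⟨L, hL⟩ := exists_bound_of_tendstoUniformly ht
    have hK0 : 0 ≤ K := (norm_nonneg _).trans (hK 0)
    have hL0 : 0 ≤ L := (norm_nonneg _).trans (hL 0)
    rw [Metric.tendstoUniformly_iff] at hs ht ⊢
    intro ε hε
    set η := min 1 (ε / (K + L + 2))
    have hη0 : 0 < η := lt_min one_pos (by positivity)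
    filter_upwards [hs η hη0, ht η hη0] with n h1 h2 z
    have h1 := h1 z
    have h2 := h2 z
    rw [dist_eq_norm] at h1 h2 ⊢
    have hη1 : η ≤ 1 := min_le_left _ _
    have hη2 : η * (K + L + 2) ≤ ε := by
      rw [← le_div_iff₀ (by positivity)]; exact min_le_right _ _
    have h3 : ‖s n z‖ ≤ K + 1 := by
      calc ‖s n z‖ = ‖F z - (F z - s n z)‖ := by rw [sub_sub_cancel]
        _ ≤ K + 1 := (norm_sub_le _ _).trans (add_le_add (hK z) (h1.le.trans hη1))
    have e : (F * G) z - (s n * t n) z = (F z - s n z) * G z + s n z * (G z - t n z) := by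
      simp only [Pi.mul_apply, SimpleFunc.mul_apply]; ring
    calc ‖(F * G) z - (s n * t n) z‖
        ≤ ‖F z - s n z‖ * ‖G z‖ + ‖s n z‖ * ‖G z - t n z‖ := by
          rw [e, ← norm_mul, ← norm_mul]; exact norm_add_le _ _
      _ ≤ η * L + (K + 1) * η := by gcongr; exact hL z
      _ < η * (K + L + 2) := by linarith
      _ ≤ ε := hη2
  · simp only [simpleIntegral_mul]
    exact (isBoundedBilinearMap_comp (𝕜 := ℂ)).continuous.continuousAt.tendsto.comp
      (hsT.prodMk_nhds htS)

variable (E) in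
theorem exists_norm_le_of_hasBoundedIntegral [CompleteSpace X] :
    ∃ C : ℝ, 0 ≤ C ∧ ∀ (F : ℂ → ℂ) (T : X →L[ℂ] X) (K : ℝ), E.HasBoundedIntegral F T →
      (∀ z, ‖F z‖ ≤ K) → ‖T‖ ≤ C * K := by
  obtain ⟨C, hC, h⟩ := E.exists_norm_simpleIntegral_le
  refine ⟨C, hC, fun F T K ⟨s, hs, hT⟩ hF => ?_⟩
  have key : ∀ δ > 0, ‖T‖ ≤ C * (K + δ) := fun δ hδ => by
    refine le_of_tendsto hT.norm ?_
    filter_upwards [Metric.tendstoUniformly_iff.1 hs δ hδ] with n hn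
    refine h _ _ fun z => ?_
    have h1 := hn z
    rw [dist_comm, dist_eq_norm] at h1
    calc ‖s n z‖ = ‖F z + (s n z - F z)‖ := by rw [add_sub_cancel]
      _ ≤ K + δ := (norm_add_le _ _).trans (add_le_add (hF z) h1.le)
  have hlim : Tendsto (fun δ : ℝ => C * (K + δ)) (𝓝[>] 0) (𝓝 (C * (K + 0))) :=
    ((continuous_const.mul (continuous_const.add continuous_id)).tendsto 0).mono_left
      nhdsWithin_le_nhds
  rw [add_zero] at hlim
  exact ge_of_tendsto hlim (eventually_mem_nhdsWithin.mono key)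

theorem HasBoundedIntegral.unique [CompleteSpace X] (hT : E.HasBoundedIntegral F T)
    (hS : E.HasBoundedIntegral F S) : T = S := by
  obtain ⟨C, -, h⟩ := E.exists_norm_le_of_hasBoundedIntegral
  have := h _ _ 0 (hT.sub hS) (by simp)
  rw [mul_zero] at this
  exact sub_eq_zero.1 (norm_le_zero_iff.1 this)

/-- Every bounded Borel function is a uniform limit of simple functions: compose it with the maps
to the nearest among finitely many points of a dense sequence. -/
theorem exists_tendstoUniformly_simpleFunc (hF : Measurable F) {K : ℝ} (hK : ∀ z, ‖F z‖ ≤ K) :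
    ∃ s : ℕ → SimpleFunc ℂ ℂ, TendstoUniformly (fun n z => s n z) F atTop := by
  set e := TopologicalSpace.denseSeq ℂ
  have hcomp : IsCompact (Metric.closedBall (0 : ℂ) K) := isCompact_closedBall 0 K
  refine ⟨fun n => (SimpleFunc.nearestPt e n).comp F hF, ?_⟩
  rw [Metric.tendstoUniformly_iff]
  intro ε hε
  obtain ⟨t, ht⟩ := hcomp.elim_finite_subcover (fun k => Metric.ball (e k) ε)
    (fun _ => Metric.isOpen_ball) fun w _ => by
      obtain ⟨k, hk⟩ := (TopologicalSpace.denseRange_denseSeq ℂ).exists_dist_lt w hε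
      exact Set.mem_iUnion.2 ⟨k, hk⟩
  filter_upwards [eventually_ge_atTop (t.sup id)] with n hn z
  have hz : F z ∈ Metric.closedBall (0 : ℂ) K := by simpa using hK z
  obtain ⟨k, hkt, hk⟩ := Set.mem_iUnion₂.1 (ht hz)
  have h := SimpleFunc.edist_nearestPt_le e (F z) ((Finset.le_sup (f := id) hkt).trans hn)
  rw [edist_dist, edist_dist, ENNReal.ofReal_le_ofReal_iff dist_nonneg] at h
  rw [dist_comm]
  rw [Metric.mem_ball, dist_comm] at hk
  exact h.trans_lt hk

theorem exists_hasBoundedIntegral [CompleteSpace X] (E : SpectralMeasure X) (hF : Measurable F)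
    {K : ℝ} (hK : ∀ z, ‖F z‖ ≤ K) : ∃ T, E.HasBoundedIntegral F T := by
  obtain ⟨s, hs⟩ := exists_tendstoUniformly_simpleFunc hF hK
  obtain ⟨C, hC, h⟩ := E.exists_norm_simpleIntegral_le
  suffices CauchySeq fun n => E.simpleIntegral (s n) by
    obtain ⟨T, hT⟩ := cauchySeq_tendsto_of_complete this
    exact ⟨T, s, hs, hT⟩
  rw [Metric.cauchySeq_iff']
  intro ε hε
  have hη : 0 < ε / (2 * (C + 1)) := by positivity
  obtain ⟨N, hN⟩ := eventually_atTop.1 (Metric.tendstoUniformly_iff.1 hs _ hη)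
  refine ⟨N, fun n hn => ?_⟩
  rw [dist_eq_norm, ← simpleIntegral_sub]
  calc _ ≤ C * (ε / (2 * (C + 1)) + ε / (2 * (C + 1))) := by
        refine h _ _ fun z => ?_
        rw [SimpleFunc.sub_apply, ← dist_eq_norm]
        exact (dist_triangle_left _ _ (F z)).trans (add_le_add (hN n hn z).le (hN N le_rfl z).le)
    _ = ε * (C / (C + 1)) := by field_simp; ring
    _ < ε := mul_lt_of_lt_one_right hε ((div_lt_one (by positivity)).2 (by linarith))

end SpectralMeasure

variable {X : Type*} [NormedAddCommGroup X] [NormedSpace ℂ X]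

/-! ### Compact operators -/

theorem isCompactOp_iff {A : X →ₗ.[ℂ] X} :
    IsCompactOp A ↔ ∃ T : X →L[ℂ] X, IsCompactOperator T ∧ ∀ x, (x, T x) ∈ A.graph := by
  constructor
  · rintro ⟨htop, hA⟩
    let J : X →L[ℂ] A.domain :=
      (ContinuousLinearMap.id ℂ X).codRestrict A.domain fun x => htop ▸ Submodule.mem_top
    have hc : IsCompactOperator (A.toFun ∘ₗ (J : X →ₗ[ℂ] A.domain)) := hA.comp_clm J
    exact ⟨.mkOfIsCompactOperator hc, hc, fun x => (A.mem_graph_iff).2 ⟨J x, rfl, rfl⟩⟩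
  · rintro ⟨T, hT, hgraph⟩
    refine ⟨Submodule.eq_top_iff'.2 fun x => A.mem_domain_of_mem_graph (hgraph x), ?_⟩
    have : (fun x : A.domain => A x) = T ∘ A.domain.subtypeL := by
      ext x
      exact A.mem_graph_snd_inj (A.mem_graph x) (hgraph x) rfl
    rw [this]
    exact hT.comp_clm _

/-- Eigenspaces of a compact operator for nonzero eigenvalues are finite-dimensional. With `c = 1`,
this applies to the range of a compact projection. -/
theorem finiteDimensional_of_isCompactOperator {T : X →L[ℂ] X} (hT : IsCompactOperator T) {c : ℂ}
    (hc : c ≠ 0) {V : Submodule ℂ X} (hV : ∀ x ∈ V, T x = c • x) : FiniteDimensional ℂ V := by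
  -- the eigenspace is closed, and `c⁻¹ • T` restricts to the identity on it
  set W : Submodule ℂ X := (T - c • ContinuousLinearMap.id ℂ X).ker with hW
  have hWmem : ∀ x ∈ W, T x = c • x := fun x hx => by
    simpa [hW, sub_eq_zero] using hx
  have hclosed : IsClosed (W : Set X) := (T - c • ContinuousLinearMap.id ℂ X).isClosed_ker
  have hmaps : ∀ x ∈ W, (c⁻¹ • T) x ∈ W := fun x hx => by
    simpa [hWmem x hx, smul_smul, hc] using hx
  have hid : IsCompactOperator (id : W → W) := by
    convert (hT.smul c⁻¹).restrict (f := ((c⁻¹ • T : X →L[ℂ] X) : X →ₗ[ℂ] X)) hmaps hclosed using 1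
    ext x
    simp [hWmem x x.2, smul_smul, hc]
  have := FiniteDimensional.of_isCompactOperator_id (𝕜 := ℂ) hid
  exact Submodule.finiteDimensional_of_le (S₂ := W) fun x hx =>
    LinearMap.mem_ker.2 (by simp [hV x hx])

theorem isCompactOperator_of_forall_mem {T : X →L[ℂ] X} (V : Submodule ℂ X)
    [FiniteDimensional ℂ V] (h : ∀ x, T x ∈ V) : IsCompactOperator T := by
  have : T = V.subtypeL.comp (T.codRestrict V h) := by ext; rfl
  rw [this]
  have := FiniteDimensional.proper ℂ V
  have hV : IsCompactOperator V.subtypeL := isCompactOperator_id.clm_comp V.subtypeL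
  exact hV.comp_clm (T.codRestrict V h)

/-! ### Spectral projections of a scalar type operator -/

section Integral

variable {A : X →ₗ.[ℂ] X} {E : SpectralMeasure X}

theorem norm_indicator_id_le (S : Set ℂ) {R : ℝ} (hR : 0 ≤ R) (z : ℂ) :
    ‖Set.indicator {z | z ∈ S ∧ ‖z‖ ≤ R} (fun z => z) z‖ ≤ R := by
  by_cases hz : z ∈ {z | z ∈ S ∧ ‖z‖ ≤ R}
  · rw [Set.indicator_of_mem hz]; exact hz.2
  · rwa [Set.indicator_of_notMem hz, norm_zero]

theorem measurableSet_norm_le {S : Set ℂ} (hS : MeasurableSet S) (R : ℝ) :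
    MeasurableSet {z : ℂ | z ∈ S ∧ ‖z‖ ≤ R} :=
  hS.inter (measurableSet_le measurable_norm measurable_const)

theorem measurableSet_le_norm {S : Set ℂ} (hS : MeasurableSet S) (R : ℝ) :
    MeasurableSet {z : ℂ | z ∈ S ∧ R ≤ ‖z‖} :=
  hS.inter (measurableSet_le measurable_const measurable_norm)

/-- The domain of `∫_S z dE` can be tested with any choice of the truncated integrals. -/
theorem mem_graph_of_tendsto [CompleteSpace X] {S : Set ℂ}
    (hA : E.HasIntegralOn S (fun z => z) A) (hS : MeasurableSet S) {x y : X}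
    (h : ∀ T : ℕ → X →L[ℂ] X,
      (∀ n : ℕ, E.HasBoundedIntegral (Set.indicator {z | z ∈ S ∧ ‖z‖ ≤ n} fun z => z) (T n)) →
      Tendsto (fun n => T n x) atTop (𝓝 y)) : (x, y) ∈ A.graph := by
  choose T hT using fun n : ℕ => E.exists_hasBoundedIntegral
    (measurable_id.indicator (measurableSet_norm_le hS (n : ℝ)))
    (norm_indicator_id_le S n.cast_nonneg)
  exact (hA x y).2 ⟨T, hT, h T hT⟩

/-- The projection attached to a point of `S` maps into the corresponding eigenspace. -/
theorem toFun_singleton_mem_eigenspace [CompleteSpace X] {S : Set ℂ}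
    (hA : E.HasIntegralOn S (fun z => z) A) (hS : MeasurableSet S) {l : ℂ} (hl : l ∈ S) (x : X) :
    E.toFun {l} x ∈ eigenspace A l := by
  change (E.toFun {l} x, l • E.toFun {l} x) ∈ A.graph
  refine mem_graph_of_tendsto hA hS fun T hT => tendsto_const_nhds.congr' ?_
  filter_upwards [eventually_ge_atTop ⌈‖l‖⌉₊] with n hn
  have h1 := (hT n).mul
    (SpectralMeasure.hasBoundedIntegral_indicator_one (E := E) (measurableSet_singleton l))
  have h2 := SpectralMeasure.hasBoundedIntegral_indicator_const (E := E)
    (measurableSet_singleton l) l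
  have e : Set.indicator {z | z ∈ S ∧ ‖z‖ ≤ n} (fun z => z) * Set.indicator {l} (fun _ => 1) =
      Set.indicator {l} fun _ => l := by
    ext z
    by_cases hz : z = l
    · subst hz
      have : z ∈ {z | z ∈ S ∧ ‖z‖ ≤ n} := ⟨hl, (Nat.le_ceil _).trans (Nat.cast_le.2 hn)⟩
      simp [Set.indicator_of_mem this]
    · simp [hz]
  rw [e] at h1
  exact (congrArg (fun P : X →L[ℂ] X => P x) (h1.unique h2)).symm

/-- If `A` is a bounded operator `T`, then `T ∘ ∫ z⁻¹ dE = E {ε ≤ |z|}`, where the integral is over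
the part `{ε ≤ |z|}` of `S`. Hence these projections factor through `T`. -/
theorem exists_comp_eq_toFun [CompleteSpace X] {S : Set ℂ}
    (hA : E.HasIntegralOn S (fun z => z) A) (hS : MeasurableSet S) {T : X →L[ℂ] X}
    (hT : ∀ x, (x, T x) ∈ A.graph) {ε : ℝ} (hε : 0 < ε) :
    ∃ R : X →L[ℂ] X, T.comp R = E.toFun {z | z ∈ S ∧ ε ≤ ‖z‖} := by
  have hm := measurableSet_le_norm hS ε
  obtain ⟨R, hR⟩ := E.exists_hasBoundedIntegral (measurable_inv.indicator hm) (K := ε⁻¹)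
    fun z => by
      by_cases hz : z ∈ {z | z ∈ S ∧ ε ≤ ‖z‖}
      · rw [Set.indicator_of_mem hz, norm_inv]
        exact inv_anti₀ hε hz.2
      · rw [Set.indicator_of_notMem hz, norm_zero]; positivity
  refine ⟨R, ContinuousLinearMap.ext fun x => ?_⟩
  obtain ⟨U, hU, hlim⟩ := (hA (R x) (T (R x))).1 (hT (R x))
  have hmn : ∀ n : ℕ, MeasurableSet {z : ℂ | (z ∈ S ∧ ε ≤ ‖z‖) ∧ ‖z‖ ≤ n} :=
    fun n => measurableSet_norm_le hm n
  have hcomp : ∀ n : ℕ, (U n).comp R = E.toFun {z | (z ∈ S ∧ ε ≤ ‖z‖) ∧ ‖z‖ ≤ n} := fun n => by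
    have h1 := (hU n).mul hR
    have h2 := SpectralMeasure.hasBoundedIntegral_indicator_one (E := E) (hmn n)
    have e : Set.indicator {z | z ∈ S ∧ ‖z‖ ≤ n} (fun z => z) *
        Set.indicator {z | z ∈ S ∧ ε ≤ ‖z‖} (fun z => z⁻¹) =
        Set.indicator {z | (z ∈ S ∧ ε ≤ ‖z‖) ∧ ‖z‖ ≤ n} fun _ => 1 := by
      ext z
      by_cases h1 : z ∈ S <;> by_cases h2 : ε ≤ ‖z‖ <;> by_cases h3 : ‖z‖ ≤ n <;>
        simp [Set.indicator, h1, h2, h3]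
      exact mul_inv_cancel₀ (norm_pos_iff.1 (hε.trans_le h2))
    rw [e] at h1
    exact h1.unique h2
  have hunion : ⋃ n : ℕ, {z : ℂ | (z ∈ S ∧ ε ≤ ‖z‖) ∧ ‖z‖ ≤ n} = {z | z ∈ S ∧ ε ≤ ‖z‖} := by
    ext z
    simp only [Set.mem_iUnion, Set.mem_ofPred_eq, exists_and_left, and_iff_left_iff_imp]
    exact fun _ => ⟨_, Nat.le_ceil _⟩
  have hlim' := E.tendsto_toFun_iUnion (s := fun n : ℕ => {z | (z ∈ S ∧ ε ≤ ‖z‖) ∧ ‖z‖ ≤ n})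
    (fun m n hmn z hz => ⟨hz.1, hz.2.trans (Nat.cast_le.2 hmn)⟩) hmn x
  rw [hunion] at hlim'
  refine tendsto_nhds_unique hlim (hlim'.congr fun n => ?_)
  rw [← hcomp n]; rfl

/-- If `E s` has finite rank and `s` contains the part of the support in an open set `O`, then that
part is finite: disjoint neighbourhoods of `k` such points give `k` independent
vectors in the range of `E s`. -/
theorem finite_support_inter_of_isOpen {s : Set ℂ} (hs : MeasurableSet s) {O : Set ℂ}
    (hO : IsOpen O) (hOs : O ∩ E.support ⊆ s) {V : Submodule ℂ X} [FiniteDimensional ℂ V]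
    (hV : ∀ x, E.toFun s x ∈ V) : (O ∩ E.support).Finite := by
  by_contra hinf
  obtain ⟨t, hts, hcard⟩ := Set.Infinite.exists_subset_card_eq hinf (Module.finrank ℂ V + 1)
  obtain ⟨U, hU, hdisj⟩ := t.finite_toSet.t2_separation
  have hne : ∀ l : t, ∃ x, E.toFun (U l ∩ O) x ≠ 0 := fun l => by
    by_contra! h
    exact (hts l.2).2 _ ((hU _).2.inter hO) ⟨(hU _).1, (hts l.2).1⟩ (ContinuousLinearMap.ext h)
  choose x hx using hne
  have hm : ∀ l : t, MeasurableSet (U l ∩ O) := fun l => ((hU _).2.inter hO).measurableSet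
  have hmem : ∀ l : t, E.toFun (U l ∩ O) (x l) ∈ V := fun l => by
    have hsm := E.isClosed_support.measurableSet
    have : E.toFun (U l ∩ O) (x l) = E.toFun s (E.toFun (U l ∩ O) (x l)) := by
      rw [E.toFun_inter_apply hs (hm l), ← E.toFun_inter_support (hm l),
        ← E.toFun_inter_support (hs.inter (hm l)), Set.inter_assoc s,
        Set.inter_eq_right.2 (fun z hz => hOs ⟨hz.1.2, hz.2⟩)]
    rw [this]
    exact hV _
  -- `E (U j ∩ O)` annihilates the vectors attached to the other points
  have hli : LinearIndependent ℂ fun l : t => (⟨_, hmem l⟩ : V) := by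
    rw [linearIndependent_iff']
    intro u g hg j hj
    have h1 : ∑ i ∈ u, g i • E.toFun (U i ∩ O) (x i) = 0 := by
      simpa using congrArg (V.subtype) hg
    have h2 := congrArg (E.toFun (U j ∩ O)) h1
    rw [map_zero, map_sum, Finset.sum_eq_single j, map_smul, E.toFun_inter_apply (hm j) (hm j),
      Set.inter_self] at h2
    · exact (smul_eq_zero.1 h2).resolve_right (hx j)
    · intro i _ hij
      have hd : (U j ∩ O) ∩ (U i ∩ O) = ∅ := Set.disjoint_iff_inter_eq_empty.1
        ((hdisj j.2 i.2 fun h => hij (Subtype.ext h.symm)).mono Set.inter_subset_left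
          Set.inter_subset_left)
      rw [map_smul, E.toFun_inter_apply (hm j) (hm i), hd, SpectralMeasure.toFun_empty]
      simp
    · exact fun h => (h hj).elim
  have := hli.fintype_card_le_finrank
  rw [Fintype.card_coe, hcard] at this
  omega

theorem isCompactOperator_toFun_of_finite {s : Set ℂ} (hs : s.Finite)
    (h : ∀ z ∈ s, IsCompactOperator (E.toFun {z})) : IsCompactOperator (E.toFun s) := by
  induction s, hs using Set.Finite.induction_on with
  | empty => rw [E.toFun_empty]; exact isCompactOperator_zero
  | @insert a s ha hs ih =>
    rw [Set.insert_eq, E.toFun_union (Set.disjoint_singleton_left.2 ha)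
      (measurableSet_singleton a) hs.measurableSet]
    exact (h a (Set.mem_insert _ _)).add (ih fun z hz => h z (Set.mem_insert_of_mem _ hz))

/-! ### Spectrum and compactness -/

variable [CompleteSpace X]

/-- The projection of `{z ∈ σ : ε / 2 ≤ |z|}` factors through the compact operator, so it has finite
rank; the smaller radius makes room for neighbourhoods of the points with `ε ≤ |z|`. -/
theorem finite_spectrum_of_isCompactOperator (hσ : E.support = spectrum A)
    (hA : E.HasIntegralOn (spectrum A) (fun z => z) A)
    {T : X →L[ℂ] X} (hT : IsCompactOperator T)
    (hgraph : ∀ x, (x, T x) ∈ A.graph) {ε : ℝ} (hε : 0 < ε) :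
    {z | z ∈ spectrum A ∧ ε ≤ ‖z‖}.Finite := by
  have hS : MeasurableSet (spectrum A) := hσ ▸ E.isClosed_support.measurableSet
  obtain ⟨R, hR⟩ := exists_comp_eq_toFun hA hS hgraph (half_pos hε)
  have hm := measurableSet_le_norm hS (ε / 2)
  set s : Set ℂ := {z | z ∈ spectrum A ∧ ε / 2 ≤ ‖z‖}
  have hc : IsCompactOperator (E.toFun s) := by
    rw [← hR]; exact hT.comp_clm R
  have := finiteDimensional_of_isCompactOperator hc one_ne_zero (V := (E.toFun s).range) (by
    rintro _ ⟨x, rfl⟩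
    rw [one_smul]
    exact (E.toFun_inter_apply hm hm x).trans (by rw [Set.inter_self]; rfl))
  have hO : IsOpen {z : ℂ | ε / 2 < ‖z‖} := isOpen_lt continuous_const continuous_norm
  refine (finite_support_inter_of_isOpen hm hO (fun z hz => ⟨hσ ▸ hz.2, (show _ < _ from hz.1).le⟩)
    (V := (E.toFun s).range) fun x => ⟨x, rfl⟩).subset fun z hz => ⟨?_, hσ ▸ hz.1⟩
  exact (half_lt_self hε).trans_le hz.2

/-- Such a point `l` is isolated in the spectrum, so `E {l}` is the projection of a neighbourhood of
a point of the support and cannot vanish. -/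
theorem isEigenvalue_of_finite (hσ : E.support = spectrum A)
    (hA : E.HasIntegralOn (spectrum A) (fun z => z) A)
    {l : ℂ} (hl : l ∈ spectrum A) (hl0 : l ≠ 0)
    (hfin : {z | z ∈ spectrum A ∧ ‖l‖ / 2 ≤ ‖z‖}.Finite) : IsEigenvalue A l := by
  have hS : MeasurableSet (spectrum A) := hσ ▸ E.isClosed_support.measurableSet
  have hpos : 0 < ‖l‖ := norm_pos_iff.2 hl0
  -- `U` is a neighbourhood of `l` that contains no other point of the spectrum
  set U : Set ℂ := {z | ‖l‖ / 2 < ‖z‖} \ ({z | z ∈ spectrum A ∧ ‖l‖ / 2 ≤ ‖z‖} \ {l})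
  have hU : IsOpen U := (isOpen_lt continuous_const continuous_norm).sdiff hfin.sdiff.isClosed
  have hlU : l ∈ U := ⟨half_lt_self hpos, fun h => h.2 rfl⟩
  have hUs : U ∩ E.support = {l} := by
    ext z
    rw [hσ]
    constructor
    · rintro ⟨⟨h1, h2⟩, h3⟩
      by_contra hz
      exact h2 ⟨⟨h3, (show _ < _ from h1).le⟩, hz⟩
    · rintro rfl
      exact ⟨hlU, hl⟩
  have hne : E.toFun {l} ≠ 0 := by
    rw [← hUs, E.toFun_inter_support hU.measurableSet]
    rw [← hσ] at hl
    exact hl U hU hlU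
  obtain ⟨x, hx⟩ : ∃ x, E.toFun {l} x ≠ 0 := by
    by_contra! h
    exact hne (ContinuousLinearMap.ext h)
  intro hbot
  have := toFun_singleton_mem_eigenspace hA hS hl x
  rw [hbot] at this
  exact hx ((Submodule.mem_bot ℂ).1 this)

/-- Here `A` is the integral of a function that vanishes on the spectrum. The bounded operator `T`
only provides that `A` is everywhere defined. -/
theorem eq_zero_of_spectrum_subset (hA : E.HasIntegralOn (spectrum A) (fun z => z) A)
    {T : X →L[ℂ] X} (hgraph : ∀ x, (x, T x) ∈ A.graph)
    (h : spectrum A ⊆ {0}) : A = 0 := by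
  have hT : ∀ x, T x = 0 := fun x => by
    obtain ⟨U, hU, hlim⟩ := (hA x (T x)).1 (hgraph x)
    have hU0 : ∀ n, U n = 0 := fun n => by
      have h0 : E.HasBoundedIntegral (fun _ => 0) 0 := by
        simpa using SpectralMeasure.hasBoundedIntegral_indicator_const (E := E) .univ 0
      refine SpectralMeasure.HasBoundedIntegral.unique (E := E) ?_ h0
      convert hU n using 1
      ext z
      by_cases hz : z ∈ spectrum A
      · have hz0 : z = 0 := h hz
        simp [Set.indicator, hz0]
      · simp [Set.indicator, hz]
    simp only [hU0] at hlim
    exact tendsto_nhds_unique hlim tendsto_const_nhds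
  have htop : A.domain = ⊤ :=
    Submodule.eq_top_iff'.2 fun x => A.mem_domain_of_mem_graph (hgraph x)
  refine LinearPMap.ext htop fun x hx _ => ?_
  exact (A.mem_graph_snd_inj (A.mem_graph ⟨x, hx⟩) (hgraph x) rfl).trans (hT x)

theorem isCompactOp_of_finite (hσ : E.support = spectrum A)
    (hA : E.HasIntegralOn (spectrum A) (fun z => z) A)
    (hfin : ∀ ε > 0, {z | z ∈ spectrum A ∧ ε ≤ ‖z‖}.Finite)
    (hdim : ∀ z ∈ spectrum A \ {0}, FiniteDimensional ℂ (eigenspace A z)) : IsCompactOp A := by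
  have hS : MeasurableSet (spectrum A) := hσ ▸ E.isClosed_support.measurableSet
  obtain ⟨R, hR⟩ : ∃ R : ℝ, ∀ z ∈ spectrum A, ‖z‖ ≤ R := by
    obtain ⟨R, hR⟩ := (hfin 1 one_pos).isBounded.exists_norm_le
    refine ⟨max R 1, fun z hz => ?_⟩
    rcases le_total 1 ‖z‖ with h | h
    · exact (hR z ⟨hz, h⟩).trans (le_max_left _ _)
    · exact h.trans (le_max_right _ _)
  have htrunc : ∀ r : ℝ, R ≤ r → {z | z ∈ spectrum A ∧ ‖z‖ ≤ r} = spectrum A := fun r hr =>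
    Set.ext fun z => ⟨fun h => h.1, fun h => ⟨h, (hR z h).trans hr⟩⟩
  obtain ⟨T, hT⟩ : ∃ T, E.HasBoundedIntegral ((spectrum A).indicator fun z => z) T := by
    refine E.exists_hasBoundedIntegral (K := max R 0) (measurable_id.indicator hS) fun z => ?_
    have := norm_indicator_id_le (spectrum A) (le_max_right R 0) z
    rwa [htrunc _ (le_max_left R 0)] at this
  refine isCompactOp_iff.2 ⟨T, ?_, fun x => ?_⟩
  · obtain ⟨C, hC, hle⟩ := E.exists_norm_le_of_hasBoundedIntegral
    -- `T` is the norm limit of the operators `T ∘ E {ε ≤ |z|}`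
    set s : ℝ → Set ℂ := fun ε => {z | z ∈ spectrum A ∧ ε ≤ ‖z‖}
    have hsm : ∀ ε, MeasurableSet (s ε) := measurableSet_le_norm hS
    refine isCompactOperator_of_tendsto (l := 𝓝[>] (0 : ℝ))
      (F := fun ε => T.comp (E.toFun (s ε))) ?_ ?_
    · rw [tendsto_iff_norm_sub_tendsto_zero]
      have hlim : Tendsto (fun ε : ℝ => C * ε) (𝓝[>] 0) (𝓝 0) := by
        simpa using ((continuous_const.mul continuous_id).tendsto (0 : ℝ)).mono_left
          (nhdsWithin_le_nhds (s := Set.Ioi 0)) (f := fun ε : ℝ => C * ε)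
      refine squeeze_zero' (Eventually.of_forall fun _ => norm_nonneg _) ?_ hlim
      filter_upwards [self_mem_nhdsWithin] with ε hε
      have hε : 0 < ε := hε
      refine hle _ _ _
        ((hT.mul (SpectralMeasure.hasBoundedIntegral_indicator_one (hsm ε))).sub hT) fun z => ?_
      by_cases hz : z ∈ spectrum A
      · by_cases hz' : ε ≤ ‖z‖
        · simp [s, Set.indicator, hz, hz', hε.le]
        · simpa [s, Set.indicator, hz, hz'] using (not_le.1 hz').le
      · simp [Set.indicator, hz, hε.le]
    · filter_upwards [self_mem_nhdsWithin] with ε hε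
      refine (isCompactOperator_toFun_of_finite (hfin ε hε) fun z hz => ?_).clm_comp T
      have hz0 : z ≠ 0 := norm_pos_iff.1 ((show 0 < ε from hε).trans_le hz.2)
      have := hdim z ⟨hz.1, hz0⟩
      exact isCompactOperator_of_forall_mem _ (toFun_singleton_mem_eigenspace hA hS hz.1)
  · refine mem_graph_of_tendsto hA hS fun U hU => tendsto_const_nhds.congr' ?_
    filter_upwards [eventually_ge_atTop ⌈R⌉₊] with n hn
    have h := hU n
    rw [htrunc n ((Nat.le_ceil R).trans (Nat.cast_le.2 hn))] at h
    rw [hT.unique h]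

end Integral

theorem zero_mem_spectrum_of_isCompactOp (hX : ¬ FiniteDimensional ℂ X) {A : X →ₗ.[ℂ] X}
    {T : X →L[ℂ] X} (hT : IsCompactOperator T) (hgraph : ∀ x, (x, T x) ∈ A.graph) :
    0 ∈ spectrum A := by
  rintro ⟨R, hR, -⟩
  refine hX (FiniteDimensional.of_isCompactOperator_id ?_)
  have hinv : id = T ∘ R := funext fun y => by
    obtain ⟨h, e⟩ := hR y
    rw [zero_smul, sub_zero] at e
    exact e.symm.trans (A.mem_graph_snd_inj (A.mem_graph ⟨R y, h⟩) (hgraph (R y)) rfl)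
  rw [hinv]
  exact hT.comp_clm R

/-! ### Sets accumulating only at zero -/

theorem tendsto_zero_of_finite {S : Set ℂ} (hfin : ∀ ε > 0, {z | z ∈ S ∧ ε ≤ ‖z‖}.Finite)
    {l : ℕ → ℂ} (hl : Set.BijOn l Set.univ (S \ {0})) : Tendsto l atTop (𝓝 0) := by
  rw [Metric.tendsto_nhds, ← Nat.cofinite_eq_atTop]
  intro ε hε
  have := (hfin ε hε).preimage (hl.injOn.mono (Set.subset_univ _))
  refine this.subset fun n hn => ⟨(hl.mapsTo (Set.mem_univ n)).1, ?_⟩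
  simpa using hn

theorem finite_of_forall_tendsto_zero {S : Set ℂ} (hc : (S \ {0}).Countable)
    (h : (S \ {0}).Infinite → ∀ l : ℕ → ℂ, Set.BijOn l Set.univ (S \ {0}) →
      Tendsto l atTop (𝓝 0)) : ∀ ε > 0, {z | z ∈ S ∧ ε ≤ ‖z‖}.Finite := by
  intro ε hε
  have hsub : {z | z ∈ S ∧ ε ≤ ‖z‖} ⊆ S \ {0} := fun z hz =>
    ⟨hz.1, norm_pos_iff.1 (hε.trans_le hz.2)⟩
  by_cases hf : (S \ {0}).Finite
  · exact hf.subset hsub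
  have := hc.to_subtype
  have := Set.infinite_coe_iff.2 hf
  obtain ⟨e⟩ : Nonempty (ℕ ≃ ↥(S \ {0})) := nonempty_equiv_of_countable
  have hl : Set.BijOn (fun n => (e n : ℂ)) Set.univ (S \ {0}) :=
    ⟨fun n _ => (e n).2, fun m _ n _ hmn => e.injective (Subtype.ext hmn),
      fun z hz => ⟨e.symm ⟨z, hz⟩, Set.mem_univ _, by simp⟩⟩
  have hev := Metric.tendsto_nhds.1 (h hf _ hl) ε hε
  rw [← Nat.cofinite_eq_atTop] at hev
  refine ((Set.Finite.image (fun n => (e n : ℂ)) hev)).subset fun z hz => ?_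
  refine ⟨e.symm ⟨z, hsub hz⟩, ?_, by simp⟩
  simpa using hz.2

theorem countable_of_finite {S : Set ℂ} (hfin : ∀ ε > 0, {z | z ∈ S ∧ ε ≤ ‖z‖}.Finite) :
    (S \ {0}).Countable := by
  refine (Set.countable_iUnion fun n : ℕ =>
    (hfin (1 / (n + 1)) Nat.one_div_pos_of_nat).countable).mono fun z hz => ?_
  obtain ⟨n, hn⟩ := exists_nat_one_div_lt (norm_pos_iff.2 hz.2)
  exact Set.mem_iUnion.2 ⟨n, hz.1, hn.le⟩

end ScalarSpectral

theorem mainTheorem6 {X : Type*} [NormedAddCommGroup X] [NormedSpace ℂ X] [CompleteSpace X]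
    (hX : ¬ FiniteDimensional ℂ X) (A : X →ₗ.[ℂ] X)
    (hA : ScalarSpectral.IsScalarTypeSpectral A) (hA0 : A ≠ 0) :
    ScalarSpectral.IsCompactOp A ↔
      (0 ∈ ScalarSpectral.spectrum A ∧
        (ScalarSpectral.spectrum A \ {0}).Nonempty ∧
        (ScalarSpectral.spectrum A \ {0}).Countable ∧
        (∀ z ∈ ScalarSpectral.spectrum A \ {0},
          ScalarSpectral.IsEigenvalue A z ∧
            FiniteDimensional ℂ (ScalarSpectral.eigenspace A z)) ∧
        ((ScalarSpectral.spectrum A \ {0}).Infinite →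
          ∀ l : ℕ → ℂ, Set.BijOn l Set.univ (ScalarSpectral.spectrum A \ {0}) →
            Tendsto l atTop (𝓝 0))) := by
  obtain ⟨-, -, E, hσ, hE⟩ := hA
  constructor
  · intro hcomp
    obtain ⟨T, hT, hgraph⟩ := ScalarSpectral.isCompactOp_iff.1 hcomp
    have hfin : ∀ ε > 0, {z | z ∈ ScalarSpectral.spectrum A ∧ ε ≤ ‖z‖}.Finite := fun ε hε =>
      ScalarSpectral.finite_spectrum_of_isCompactOperator hσ hE hT hgraph hε
    refine ⟨ScalarSpectral.zero_mem_spectrum_of_isCompactOp hX hT hgraph, ?_,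
      ScalarSpectral.countable_of_finite hfin, fun z hz => ⟨?_, ?_⟩,
      fun _ l hl => ScalarSpectral.tendsto_zero_of_finite hfin hl⟩
    · by_contra hne
      exact hA0 (ScalarSpectral.eq_zero_of_spectrum_subset hE hgraph
        (Set.sdiff_eq_empty.1 (Set.not_nonempty_iff_eq_empty.1 hne)))
    · exact ScalarSpectral.isEigenvalue_of_finite hσ hE hz.1 hz.2
        (hfin _ (half_pos (norm_pos_iff.2 hz.2)))
    · exact ScalarSpectral.finiteDimensional_of_isCompactOperator hT hz.2 fun x hx =>
        A.mem_graph_snd_inj (hgraph x) (show (x, z • x) ∈ A.graph from hx) rfl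
  · rintro ⟨-, -, hcount, heig, hlim⟩
    exact ScalarSpectral.isCompactOp_of_finite hσ hE
      (ScalarSpectral.finite_of_forall_tendsto_zero hcount hlim) fun z hz => (heig z hz).2
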